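/- **Theorem A (Tits' Alternative).** Let $\mathbb{X}=\prod_{i=1}^{D}X_i$ be a finite product of complete separable geodesic metric spaces, each $\delta$-hyperbolic for some common $\delta$ (for every geodesic triangle, the fibres of the map to its comparison tripod have diameter at most $\delta$), equipped with the $\ell^p$-product metric $d$ for some $p\in[1,\infty]$. Let $\mathrm{Aut}\,\mathbb{X}$ be the group of those isometries of $\mathbb{X}$ which permute the factors and act through isometries between the factors, i.e. the maps $f$ for which there are a permutation $\sigma$ of $\{1,\dots,D\}$ and surjective isometries $e_i:X_i\to X_{\sigma(i)}$ with $f(x)_{\sigma(i)}=e_i(x_i)$ for all $x$ and $i$. Let $\Gamma$ be a countable discrete group and $\Gamma\to\mathrm{Aut}\,\mathbb{X}$ a homomorphism such that the resulting action on $\mathbb{X}$ is - acylindrical: for every $\epsilon>0$ there are $R\ge 0$ and $N\in\mathbb{N}$ such that for all $x,y\in\mathbb{X}$ with $d(x,y)\ge R$ at most $N$ elements $g\in\Gamma$ satisfy both $d(gx,x)\le\epsilon$ and $d(gy,y)\le\epsilon$; and - not elliptic: not all orbits of $\Gamma$ in $\mathbb{X}$ are bounded. Then either $\Gamma$ contains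 a free group of rank $2$, or $\Gamma$ is virtually isomorphic to $\mathbb{Z}^k$ for some $k$ with $1\le k\le D$. Here two groups $\Gamma,\Lambda$ are virtually isomorphic if there are finite index subgroups $\Gamma'\le\Gamma$, $\Lambda'\le\Lambda$ and finite normal subgroups $K\trianglelefteq\Gamma'$, $L\trianglelefteq\Lambda'$ with $\Gamma'/K\cong\Lambda'/L$. -/

import Mathlib

open scoped ENNReal

/-! ### Geodesic and hyperbolic metric spaces -/

/-- `γ` restricted to `[0, d(a,b)]` is a geodesic from `a` to `b`, parametrised by arc length. -/
def IsGeodesicFromTo {X : Type*} [MetricSpace X] (γ : ℝ → X) (a b : X) : Prop :=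
  γ 0 = a ∧ γ (dist a b) = b ∧
    ∀ s ∈ Set.Icc (0 : ℝ) (dist a b), ∀ t ∈ Set.Icc (0 : ℝ) (dist a b),
      dist (γ s) (γ t) = |s - t|

/-- Any two points are joined by a geodesic. -/
def IsGeodesicSpace (X : Type*) [MetricSpace X] : Prop :=
  ∀ a b : X, ∃ γ : ℝ → X, IsGeodesicFromTo γ a b

/-- The Gromov product `⟨x, y⟩_o`. -/
noncomputable def gromovProduct {X : Type*} [MetricSpace X] (o x y : X) : ℝ :=
  (dist x o + dist o y - dist x y) / 2

/-- A geodesic space is `δ`-hyperbolic if, for every geodesic triangle, the fibres of the map to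
its comparison tripod have diameter at most `δ`.  The leg of the tripod at the vertex coming from
`a` has length `⟨b, c⟩_a`, and two points on different sides lie in the same fibre exactly when
they lie on the two sides issuing from a common vertex `a`, at the same distance
`t ≤ ⟨b, c⟩_a` from it (`t = ⟨b, c⟩_a` for the fibre over the centre). -/
def IsHyperbolicSpace (δ : ℝ) (X : Type*) [MetricSpace X] : Prop :=
  IsGeodesicSpace X ∧
    ∀ (a b c : X) (γ η : ℝ → X), IsGeodesicFromTo γ a b → IsGeodesicFromTo η a c →
      ∀ t ∈ Set.Icc (0 : ℝ) (gromovProduct a b c), dist (γ t) (η t) ≤ δ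

/-! ### Isometric actions -/

section Actions

variable {Γ Y : Type*} [Group Γ] [MetricSpace Y]

/-- The `ε`-coarse stabilizer of a set `S` of points. -/
def coarseStabilizer (ρ : Γ →* (Y ≃ᵢ Y)) (ε : ℝ) (S : Set Y) : Set Γ :=
  {g | ∀ x ∈ S, dist (ρ g x) x ≤ ε}

/-- Acylindrical actions by isometries. -/
def IsAcylindrical (ρ : Γ →* (Y ≃ᵢ Y)) : Prop :=
  ∀ ε : ℝ, 0 < ε → ∃ (R : ℝ) (N : ℕ), 0 ≤ R ∧
    ∀ x y : Y, R ≤ dist x y → (coarseStabilizer ρ ε {x, y}).encard ≤ N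

/-- Elliptic actions by isometries: all orbits are bounded. -/
def IsElliptic (ρ : Γ →* (Y ≃ᵢ Y)) : Prop :=
  ∀ x : Y, Bornology.IsBounded (Set.range fun g : Γ => ρ g x)

end Actions

/-! ### Automorphisms of a finite product -/

/-- The automorphism group of the product of `X 0, …, X (D - 1)` with its `ℓ^p` metric: the
isometries that permute (isometric) factors through isometries between the factors. -/
def autProd {D : ℕ} (p : ℝ≥0∞) [Fact (1 ≤ p)] (X : Fin D → Type*) [∀ i, MetricSpace (X i)] :
    Subgroup (PiLp p X ≃ᵢ PiLp p X) where
  carrier := {f | ∃ σ : Equiv.Perm (Fin D), ∀ i, ∃ e : X i ≃ᵢ X (σ i),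
    ∀ x : PiLp p X, f x (σ i) = e (x i)}
  one_mem' := ⟨1, fun i => ⟨IsometryEquiv.refl (X i), fun _ => rfl⟩⟩
  mul_mem' := by
    rintro f g ⟨σ, hf⟩ ⟨τ, hg⟩
    refine ⟨σ * τ, fun i => ?_⟩
    obtain ⟨e, he⟩ := hg i
    obtain ⟨e', he'⟩ := hf (τ i)
    refine ⟨e.trans e', fun x => ?_⟩
    change f (g x) (σ (τ i)) = e' (e (x i))
    rw [he', he]
  inv_mem' := by
    rintro f ⟨σ, hf⟩
    refine ⟨σ⁻¹, fun j => ?_⟩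
    have key : ∀ k, σ k = j → ∃ e : X j ≃ᵢ X k, ∀ x : PiLp p X, f⁻¹ x k = e (x j) := by
      rintro k rfl
      obtain ⟨e, he⟩ := hf k
      refine ⟨e.symm, fun x => ?_⟩
      have h := he (f⁻¹ x)
      rw [IsometryEquiv.apply_inv_self] at h
      rw [h, IsometryEquiv.symm_apply_apply]
    exact key (σ⁻¹ j) (σ.apply_symm_apply j)

/-! ### Virtual isomorphism -/

/-- `G` and `H` have finite index subgroups with isomorphic quotients by finite normal
subgroups. -/
def VirtuallyIsomorphic (G H : Type*) [Group G] [Group H] : Prop :=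
  ∃ (G' : Subgroup G) (H' : Subgroup H) (K : Subgroup G') (L : Subgroup H')
    (_ : K.Normal) (_ : L.Normal),
    G'.FiniteIndex ∧ H'.FiniteIndex ∧ Finite K ∧ Finite L ∧ Nonempty (G' ⧸ K ≃* H' ⧸ L)

/-! A finite index subgroup preserves every factor, so the problem becomes that of a group acting on
each `X i` separately. On one factor with unbounded orbits, either ping-pong produces a free group
or a finite index subgroup fixes a point at infinity (`exists_free_or_exists_finiteIndex_fixing`).
Loxodromic and parabolic fixed points need no distinction. A horofunction at the fixed point gives a
quasimorphism `f i`, and far out towards that point each `g` moves points by at most `|f i g|` plus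
a constant (`exists_controlsDisplacement_of_fixing`). A factor with bounded orbits gets `f i = 0`.

On the intersection of these subgroups acylindricity makes the `f i` jointly proper: infinitely many
elements with all `|f i g|` bounded would coarsely fix two points far apart. Quasimorphisms are
bounded on commutators, so there are finitely many commutators, the commutator subgroup is finite,
and each `f i` is close to a homomorphism (`exists_hom_near_quasimorphism`). Together these
homomorphisms have finite kernel and discrete image in `ℝ^D`, hence image `ℤ^k` with `k ≤ D`. If `k
= 0` the group is finite, against the unbounded orbit. -/

open Filter Topology

/-! ### Gromov products and the four point inequality -/

section GromovProduct

variable {X : Type*} [MetricSpace X]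

theorem gromovProduct_comm (o x y : X) : gromovProduct o x y = gromovProduct o y x := by
  unfold gromovProduct
  rw [dist_comm x y, dist_comm x o, dist_comm o y]
  ring

theorem gromovProduct_nonneg (o x y : X) : 0 ≤ gromovProduct o x y := by
  have := dist_triangle x o y
  unfold gromovProduct
  linarith

theorem gromovProduct_le_dist (o x y : X) : gromovProduct o x y ≤ dist o x := by
  have := dist_triangle o x y
  have := dist_comm o x
  unfold gromovProduct
  linarith

theorem gromovProduct_le_dist' (o x y : X) : gromovProduct o x y ≤ dist o y := by
  rw [gromovProduct_comm]
  exact gromovProduct_le_dist o y x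

theorem gromovProduct_add_gromovProduct (o x y : X) :
    gromovProduct o x y + gromovProduct x o y = dist o x := by
  have := dist_comm o x
  unfold gromovProduct
  linarith

@[simp] theorem gromovProduct_self_left (o x : X) : gromovProduct o o x = 0 := by
  simp [gromovProduct]

@[simp] theorem gromovProduct_self_right (o x : X) : gromovProduct o x o = 0 := by
  simp [gromovProduct]

theorem gromovProduct_le_add_dist_base (o o' x y : X) :
    gromovProduct o x y ≤ gromovProduct o' x y + dist o o' := by
  have h1 := dist_triangle x o' o
  have h2 := dist_triangle o o' y
  have h3 := dist_comm o o'
  unfold gromovProduct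
  linarith

theorem gromovProduct_le_add_dist_right (o x y y' : X) :
    gromovProduct o x y ≤ gromovProduct o x y' + dist y y' := by
  have h1 := dist_triangle o y' y
  have h2 := dist_triangle x y y'
  have h3 := dist_comm y y'
  unfold gromovProduct
  linarith

theorem gromovProduct_smul {G : Type*} [Group G] [MulAction G X] [IsIsometricSMul G X]
    (g : G) (o x y : X) : gromovProduct (g • o) (g • x) (g • y) = gromovProduct o x y := by
  simp [gromovProduct]

theorem gromovProduct_smul_base {G : Type*} [Group G] [MulAction G X] [IsIsometricSMul G X]
    (g : G) (o x y : X) :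
    gromovProduct (g • o) x y = gromovProduct o (g⁻¹ • x) (g⁻¹ • y) := by
  rw [← gromovProduct_smul g o, smul_inv_smul, smul_inv_smul]

/-- The four point formulation of hyperbolicity. -/
def FourPoint (δ : ℝ) (X : Type*) [MetricSpace X] : Prop :=
  ∀ o x y z : X, min (gromovProduct o x y) (gromovProduct o y z) ≤ gromovProduct o x z + δ

theorem FourPoint.nonneg {δ : ℝ} (h : FourPoint δ X) (o : X) : 0 ≤ δ := by
  simpa using h o o o o

/-- The four point inequality in terms of sums of distances. -/
theorem FourPoint.dist_add_dist_le {δ : ℝ} (h : FourPoint δ X) (x y z w : X) :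
    dist x y + dist z w ≤ max (dist x z + dist y w) (dist x w + dist y z) + 2 * δ := by
  have := h w x z y
  have e1 := dist_comm z y
  have e2 := dist_comm w y
  have e3 := dist_comm w z
  unfold gromovProduct at this
  rcases min_le_iff.1 this with h | h
  · have := le_max_right (dist x z + dist y w) (dist x w + dist y z)
    have := le_max_left (dist x z + dist y w) (dist x w + dist y z)
    linarith
  · have := le_max_right (dist x z + dist y w) (dist x w + dist y z)
    have := le_max_left (dist x z + dist y w) (dist x w + dist y z)
    linarith

theorem IsGeodesicFromTo.dist_left {γ : ℝ → X} {a b : X} (h : IsGeodesicFromTo γ a b) {t : ℝ}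
    (h0 : 0 ≤ t) (h1 : t ≤ dist a b) : dist a (γ t) = t := by
  have := h.2.2 0 ⟨le_rfl, dist_nonneg⟩ t ⟨h0, h1⟩
  rwa [h.1, zero_sub, abs_neg, abs_of_nonneg h0] at this

theorem IsGeodesicFromTo.dist_right {γ : ℝ → X} {a b : X} (h : IsGeodesicFromTo γ a b) {t : ℝ}
    (h0 : 0 ≤ t) (h1 : t ≤ dist a b) : dist (γ t) b = dist a b - t := by
  have := h.2.2 t ⟨h0, h1⟩ (dist a b) ⟨dist_nonneg, le_rfl⟩
  rw [h.2.1, abs_of_nonpos (by linarith)] at this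
  linarith

/-- At distance `t`, the smaller of the two products, the geodesics from `o` to `x` and to `z` both
lie within `δ` of the one to `y`. The path from `x` to `z` crossing there bounds `dist x z`. -/
theorem IsHyperbolicSpace.fourPoint {δ : ℝ} (h : IsHyperbolicSpace δ X) : FourPoint δ X := by
  intro o x y z
  obtain ⟨γx, hx⟩ := h.1 o x
  obtain ⟨γy, hy⟩ := h.1 o y
  obtain ⟨γz, hz⟩ := h.1 o z
  set t := min (gromovProduct o x y) (gromovProduct o y z) with ht
  have h0 : 0 ≤ t := le_min (gromovProduct_nonneg _ _ _) (gromovProduct_nonneg _ _ _)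
  have t1 : t ≤ gromovProduct o x y := min_le_left _ _
  have t2 : t ≤ gromovProduct o y z := min_le_right _ _
  have h1 := h.2 o x y γx γy hx hy t ⟨h0, t1⟩
  have h2 := h.2 o y z γy γz hy hz t ⟨h0, t2⟩
  have h3 := hx.dist_right h0 (t1.trans (gromovProduct_le_dist _ _ _))
  have h4 := hz.dist_right h0 (t2.trans (gromovProduct_le_dist' _ _ _))
  have h5 := dist_triangle4 x (γx t) (γz t) z
  have h6 := dist_triangle (γx t) (γy t) (γz t)
  have e1 := dist_comm x (γx t)
  have e2 := dist_comm x o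
  unfold gromovProduct
  linarith

end GromovProduct

/-! ### Ping-pong -/

section PingPong

variable {X G : Type*} [MetricSpace X] [Group G] [MulAction G X] [IsIsometricSMul G X]
  {δ : ℝ} {o : X}

/-- The product `gromovProduct o (g⁻¹ • o) (h • o)` is the backtracking at the corner `g • o` of the
path `o`, `g • o`, `(g * h) • o`, translated back to `o`. -/
theorem gromovProduct_smul_mul (o : X) (g h : G) :
    gromovProduct o (g • o) ((g * h) • o) = dist o (g • o) - gromovProduct o (g⁻¹ • o) (h • o) := by
  rw [← gromovProduct_add_gromovProduct o (g • o) ((g * h) • o), gromovProduct_smul_base]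
  simp [mul_smul]

theorem dist_smul_mul (o : X) (g h : G) :
    dist o ((g * h) • o) =
      dist o (g • o) + dist o (h • o) - 2 * gromovProduct o (g⁻¹ • o) (h • o) := by
  have h1 : dist (g⁻¹ • o) o = dist o (g • o) := by
    rw [← dist_smul g, smul_inv_smul]
  have h2 : dist (g⁻¹ • o) (h • o) = dist o ((g * h) • o) := by
    rw [← dist_smul g, smul_inv_smul, mul_smul]
  unfold gromovProduct
  rw [h1, h2]
  ring

theorem dist_inv_smul_self (o : X) (g : G) : dist o (g⁻¹ • o) = dist o (g • o) := by
  rw [← dist_smul g, smul_inv_smul, dist_comm]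

/-- A broken geodesic with long pieces and small Gromov products at its corners makes definite
progress. -/
theorem FourPoint.length_le_dist_list_prod (hX : FourPoint δ X) {K : ℝ} (hK : 0 ≤ K) (l : List G) :
    ∀ s : G, (∀ t ∈ l, 2 * K + 2 * δ + 1 ≤ dist o (t • o)) →
      (s :: l).IsChain (fun s t => gromovProduct o (s⁻¹ • o) (t • o) ≤ K) →
      gromovProduct o (s⁻¹ • o) (l.prod • o) ≤ K + δ ∧ (l.length : ℝ) ≤ dist o (l.prod • o) := by
  have hδ := hX.nonneg o
  induction l with
  | nil => intro s _ _; simp; linarith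
  | cons t l ih =>
    intro s hl hc
    rw [List.isChain_cons_cons] at hc
    obtain ⟨ih1, ih2⟩ := ih t (fun u hu => hl u (List.mem_cons_of_mem _ hu)) hc.2
    have ht := hl t List.mem_cons_self
    have e1 := gromovProduct_smul_mul o t l.prod
    have e2 := dist_smul_mul o t l.prod
    rw [List.prod_cons]
    -- By `e1` the product of `t • o` and `(t * l.prod) • o` is at least `K + δ + 1`, so the four
    -- point inequality passes the corner bound from `t • o` to the whole word. The length `2 * K +
    -- 2 * δ + 1` pays for the corner and leaves a gain of `1` per letter.
    constructor
    · have := hX o (s⁻¹ • o) ((t * l.prod) • o) (t • o)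
      rw [gromovProduct_comm o _ (t • o)] at this
      rcases min_le_iff.1 this with h | h <;> linarith [hc.1]
    · push_cast [List.length_cons]
      linarith

/-- A nontrivial reduced word is a broken geodesic without sharp corners, so it moves `o` by at
least its length. -/
theorem FourPoint.injective_lift (hX : FourPoint δ X) {α : Type*} (a : α → G) {K : ℝ}
    (hK : 0 ≤ K) (hlong : ∀ i, 2 * K + 2 * δ + 1 ≤ dist o (a i • o))
    (hprod : ∀ p q : α × Bool, (p.1 = q.1 → p.2 = q.2) →
      gromovProduct o ((cond p.2 (a p.1) (a p.1)⁻¹)⁻¹ • o) (cond q.2 (a q.1) (a q.1)⁻¹ • o) ≤ K) :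
    Function.Injective (FreeGroup.lift a) := by
  classical
  rw [injective_iff_map_eq_one]
  intro w hw
  by_contra hne
  have hred : FreeGroup.IsReduced w.toWord := FreeGroup.isReduced_toWord
  rw [← FreeGroup.mk_toWord (x := w), FreeGroup.lift_mk] at hw
  cases hl : w.toWord with
  | nil => exact hne (FreeGroup.toWord_eq_nil_iff.1 hl)
  | cons p l =>
    rw [hl] at hw hred
    -- The chain needs a letter in front of the word; repeating the first letter `p` creates no
    -- cancellation.
    have := (hX.length_le_dist_list_prod (o := o) hK
      ((p :: l).map fun x => cond x.2 (a x.1) (a x.1)⁻¹) (cond p.2 (a p.1) (a p.1)⁻¹) ?_ ?_).2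
    · rw [hw] at this
      simp at this
      linarith
    · intro t ht
      obtain ⟨⟨i, b⟩, -, rfl⟩ := List.mem_map.1 ht
      cases b
      · simpa [dist_inv_smul_self] using hlong i
      · exact hlong i
    · rw [← List.map_cons (f := fun x : α × Bool => cond x.2 (a x.1) (a x.1)⁻¹), List.isChain_map]
      refine List.IsChain.imp (fun p q h => hprod p q h) ?_
      exact FreeGroup.isReduced_cons_cons.2 ⟨fun _ => rfl, hred⟩

/-- A quantitative criterion for an isometry to be loxodromic. -/
def IsLoxodromicAt (δ : ℝ) (o : X) (g : G) : Prop :=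
  2 * gromovProduct o (g⁻¹ • o) (g • o) + 3 * δ + 1 ≤ dist o (g • o)

theorem IsLoxodromicAt.inv {g : G} (h : IsLoxodromicAt δ o g) : IsLoxodromicAt δ o g⁻¹ := by
  unfold IsLoxodromicAt at *
  rwa [inv_inv, gromovProduct_comm, dist_inv_smul_self]

/-- Every corner of the constant word `g ⋯ g` has the same Gromov product, which serves as `K`. -/
theorem IsLoxodromicAt.pow_bounds (hX : FourPoint δ X) {g : G} (h : IsLoxodromicAt δ o g) (n : ℕ) :
    gromovProduct o (g⁻¹ • o) (g ^ n • o) ≤ gromovProduct o (g⁻¹ • o) (g • o) + δ ∧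
      (n : ℝ) ≤ dist o (g ^ n • o) := by
  have hδ := hX.nonneg o
  have := hX.length_le_dist_list_prod (o := o)
    (gromovProduct_nonneg o (g⁻¹ • o) (g • o)) (List.replicate n g) g ?_ ?_
  · simpa using this
  · intro t ht
    rw [List.eq_of_mem_replicate ht]
    unfold IsLoxodromicAt at h
    linarith
  · rw [← List.replicate_succ]
    exact List.isChain_replicate_of_rel _ le_rfl

/-- The bound for `g⁻¹ • o` against `g ^ n • o` passes to every positive power of `g⁻¹`, since these
share a long initial direction with `g⁻¹ • o`. The slack `3 * δ` in `IsLoxodromicAt` is what this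
requires. -/
theorem IsLoxodromicAt.gromovProduct_pow_le (hX : FourPoint δ X) {g : G}
    (h : IsLoxodromicAt δ o g) (m n : ℕ) :
    gromovProduct o ((g⁻¹) ^ m • o) (g ^ n • o) ≤
      gromovProduct o (g⁻¹ • o) (g • o) + 2 * δ := by
  have hδ := hX.nonneg o
  have h0 := gromovProduct_nonneg o (g⁻¹ • o) (g • o)
  cases m with
  | zero => simp; linarith
  | succ m =>
    have h1 := (h.pow_bounds hX n).1
    have h2 := (h.inv.pow_bounds hX m).1
    rw [inv_inv, gromovProduct_comm o (g • o)] at h2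
    have h3 := gromovProduct_smul_mul o g⁻¹ (g⁻¹ ^ m)
    rw [inv_inv, ← pow_succ', dist_inv_smul_self, gromovProduct_comm o (g • o)] at h3
    have h4 := hX o (g⁻¹ • o) (g⁻¹ ^ (m + 1) • o) (g ^ n • o)
    rw [gromovProduct_comm o (g • o)] at h2
    unfold IsLoxodromicAt at h
    rcases min_le_iff.1 h4 with h | h <;> linarith

theorem IsLoxodromicAt.le_gromovProduct_pow (hX : FourPoint δ X) {g : G}
    (h : IsLoxodromicAt δ o g) {m n : ℕ} (hmn : m ≤ n) :
    m - (gromovProduct o (g⁻¹ • o) (g • o) + 2 * δ) ≤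
      gromovProduct o (g ^ m • o) (g ^ n • o) := by
  obtain ⟨k, rfl⟩ := Nat.exists_eq_add_of_le hmn
  have h1 := h.gromovProduct_pow_le hX m k
  rw [pow_add, gromovProduct_smul_mul, ← inv_pow]
  linarith [(h.pow_bounds hX m).2]

/-- If two isometries, neither of them loxodromic, are transverse, then their product is
loxodromic. -/
theorem isLoxodromicAt_mul (hX : FourPoint δ X) {g h : G} (hg : ¬ IsLoxodromicAt δ o g)
    (hh : ¬ IsLoxodromicAt δ o h)
    (hgl : 2 * gromovProduct o (g • o) (h • o) + 8 * δ + 1 < dist o (g • o))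
    (hhl : 2 * gromovProduct o (g • o) (h • o) + 8 * δ + 1 < dist o (h • o)) :
    IsLoxodromicAt δ o (g * h) := by
  have hδ := hX.nonneg o
  unfold IsLoxodromicAt at *
  push Not at hg hh
  set p := gromovProduct o (g • o) (h • o)
  have hp : 0 ≤ p := gromovProduct_nonneg _ _ _
  -- As `g` is not loxodromic, `g • o` and `g⁻¹ • o` leave `o` in nearly the same direction, so
  -- `g⁻¹` is transverse to `h` too; likewise `g` and `h⁻¹`.
  have h1 : gromovProduct o (g⁻¹ • o) (h • o) ≤ p + δ := by
    have := hX o (g • o) (g⁻¹ • o) (h • o)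
    rw [gromovProduct_comm o (g • o) (g⁻¹ • o)] at this
    rcases min_le_iff.1 this with h | h <;> linarith
  have h2 : gromovProduct o (g • o) (h⁻¹ • o) ≤ p + δ := by
    have := hX o (g • o) (h⁻¹ • o) (h • o)
    rcases min_le_iff.1 this with h | h <;> linarith
  have e1 := dist_smul_mul o g h
  have e2 := gromovProduct_smul_mul o g h
  have e3 := gromovProduct_smul_mul o h⁻¹ g⁻¹
  rw [inv_inv, ← mul_inv_rev, dist_inv_smul_self, gromovProduct_comm o (h • o)] at e3
  -- The point `(g * h) • o` lies in the direction of `g • o` and its inverse in that of `h⁻¹ • o`;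
  -- these directions are transverse by `h2`.
  have h3 : gromovProduct o ((g * h)⁻¹ • o) ((g * h) • o) ≤ p + 3 * δ := by
    have a1 := hX o (g • o) ((g * h) • o) (h⁻¹ • o)
    have a2 := hX o ((g * h) • o) ((g * h)⁻¹ • o) (h⁻¹ • o)
    rw [gromovProduct_comm o _ (h⁻¹ • o), gromovProduct_comm o ((g * h) • o)] at a2
    rw [gromovProduct_comm o ((g * h) • o) (h⁻¹ • o)] at a1
    rw [gromovProduct_comm o ((g * h) • o) (h⁻¹ • o)] at a2
    rcases min_le_iff.1 a1 with h | h <;> rcases min_le_iff.1 a2 with h' | h' <;> linarith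
  linarith

end PingPong

/-! ### Sequences converging to infinity -/

section Asymptotic

variable {X G : Type*} [MetricSpace X] [Group G] [MulAction G X] [IsIsometricSMul G X]
  {δ : ℝ} {o : X}

/-- The Gromov products of the corresponding terms of two sequences tend to infinity: the two
sequences converge to the same point at infinity. -/
def AsymptoticSeq (o : X) (x y : ℕ → X) : Prop :=
  Tendsto (fun n => gromovProduct o (x n) (y n)) atTop atTop

/-- Gromov sequences: sequences that converge to a point at infinity. -/
def GromovSeq (o : X) (x : ℕ → X) : Prop :=
  ∀ B : ℝ, ∃ N : ℕ, ∀ m ≥ N, ∀ n ≥ N, B ≤ gromovProduct o (x m) (x n)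

theorem AsymptoticSeq.symm {x y : ℕ → X} (h : AsymptoticSeq o x y) : AsymptoticSeq o y x := by
  simpa only [AsymptoticSeq, gromovProduct_comm o] using
    h.congr fun n => gromovProduct_comm o (x n) (y n)

theorem AsymptoticSeq.trans (hX : FourPoint δ X) {x y z : ℕ → X} (h : AsymptoticSeq o x y)
    (h' : AsymptoticSeq o y z) : AsymptoticSeq o x z := by
  refine tendsto_atTop.2 fun B => ?_
  filter_upwards [tendsto_atTop.1 h (B + δ), tendsto_atTop.1 h' (B + δ)] with n h1 h2
  linarith [hX o (x n) (y n) (z n), le_min h1 h2]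

theorem AsymptoticSeq.smul {x y : ℕ → X} (h : AsymptoticSeq o x y) (g : G) :
    AsymptoticSeq o (fun n => g • x n) fun n => g • y n := by
  refine tendsto_atTop.2 fun B => ?_
  filter_upwards [tendsto_atTop.1 h (B + dist (g • o) o)] with n h1
  have h2 := gromovProduct_le_add_dist_base (g • o) o (g • x n) (g • y n)
  rw [gromovProduct_smul] at h2
  linarith

theorem GromovSeq.asymptoticSeq {x : ℕ → X} (h : GromovSeq o x) : AsymptoticSeq o x x := by
  refine tendsto_atTop.2 fun B => ?_
  obtain ⟨N, hN⟩ := h B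
  exact eventually_atTop.2 ⟨N, fun n hn => hN n hn n hn⟩

theorem GromovSeq.smul {x : ℕ → X} (h : GromovSeq o x) (g : G) :
    GromovSeq o fun n => g • x n := by
  intro B
  obtain ⟨N, hN⟩ := h (B + dist (g • o) o)
  refine ⟨N, fun m hm n hn => ?_⟩
  have h2 := gromovProduct_le_add_dist_base (g • o) o (g • x m) (g • x n)
  rw [gromovProduct_smul] at h2
  linarith [hN m hm n hn]

/-- Two Gromov sequences that do not converge to the same point at infinity have bounded Gromov
products. -/
theorem GromovSeq.eventually_le_of_not_asymptoticSeq (hX : FourPoint δ X) {x y : ℕ → X}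
    (hx : GromovSeq o x) (hy : GromovSeq o y) (h : ¬ AsymptoticSeq o x y) :
    ∃ K : ℝ, ∀ᶠ n in atTop, gromovProduct o (x n) (y n) ≤ K := by
  have hδ := hX.nonneg o
  simp only [AsymptoticSeq, tendsto_atTop, not_forall, not_eventually, not_le] at h
  obtain ⟨B, hB⟩ := h
  obtain ⟨N, hN⟩ := hx (B + 2 * δ)
  obtain ⟨N', hN'⟩ := hy (B + 2 * δ)
  refine ⟨B + 2 * δ, ?_⟩
  filter_upwards [eventually_ge_atTop N, eventually_ge_atTop N'] with n hn hn'
  -- One late index with a small product suffices: both sequences are nearly constant in direction,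
  -- so two four point inequalities carry the bound from `m` to `n`.
  obtain ⟨m, hm, hBm⟩ := frequently_atTop.1 hB (max N N')
  have a1 := hN m ((le_max_left _ _).trans hm) n hn
  have a2 := hN' n hn' m ((le_max_right _ _).trans hm)
  have a3 := hX o (x m) (x n) (y m)
  have a4 := hX o (x n) (y n) (y m)
  rcases min_le_iff.1 a3 with h | h <;> rcases min_le_iff.1 a4 with h' | h' <;> linarith

/-- The stabilizer of the point at infinity to which a sequence converges. -/
def seqStabilizer (hX : FourPoint δ X) (G : Type*) [Group G] [MulAction G X] [IsIsometricSMul G X]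
    {x : ℕ → X} (hx : AsymptoticSeq o x x) : Subgroup G where
  carrier := {g | AsymptoticSeq o (fun n => g • x n) x}
  one_mem' := by simpa using hx
  mul_mem' := by
    intro g h hg hh
    have := (AsymptoticSeq.smul hh g).trans hX hg
    simpa [mul_smul] using this
  inv_mem' := by
    intro g hg
    have := (AsymptoticSeq.smul hg g⁻¹).symm
    simpa using this

theorem mem_seqStabilizer {hX : FourPoint δ X} {x : ℕ → X} {hx : AsymptoticSeq o x x} {g : G} :
    g ∈ seqStabilizer hX G hx ↔ AsymptoticSeq o (fun n => g • x n) x := Iff.rfl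

/-- The elements that move one point at infinity to another one lie in a single coset. -/
theorem exists_coset_of_asymptoticSeq (hX : FourPoint δ X) {x : ℕ → X}
    (hx : AsymptoticSeq o x x) (y : ℕ → X) :
    ∃ g₀ : G, ∀ g : G, AsymptoticSeq o (fun n => g • x n) y →
      g₀⁻¹ * g ∈ seqStabilizer hX G hx := by
  by_cases h : ∃ g₀ : G, AsymptoticSeq o (fun n => g₀ • x n) y
  · obtain ⟨g₀, h₀⟩ := h
    refine ⟨g₀, fun g hg => ?_⟩
    have := (hg.trans hX h₀.symm).smul g₀⁻¹
    simpa [mem_seqStabilizer, mul_smul] using this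
  · push Not at h
    exact ⟨1, fun g hg => absurd hg (h g)⟩

theorem IsLoxodromicAt.gromovSeq (hX : FourPoint δ X) {g : G} (h : IsLoxodromicAt δ o g) :
    GromovSeq o fun n => g ^ n • o := by
  intro B
  obtain ⟨N, hN⟩ := exists_nat_ge (B + (gromovProduct o (g⁻¹ • o) (g • o) + 2 * δ))
  have key : ∀ m ≥ N, ∀ n ≥ m, B ≤ gromovProduct o (g ^ m • o) (g ^ n • o) := by
    intro m hm n hn
    have h1 := h.le_gromovProduct_pow hX hn
    have h2 : (N : ℝ) ≤ m := by exact_mod_cast hm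
    linarith
  refine ⟨N, fun m hm n hn => ?_⟩
  rcases le_total m n with hmn | hmn
  · exact key m hm n hmn
  · rw [gromovProduct_comm]
    exact key n hn m hmn

/-- If a conjugate of a loxodromic isometry `g` has no fixed point at infinity in common with `g`,
then high powers of the two generate a free group. -/
theorem IsLoxodromicAt.exists_free (hX : FourPoint δ X) {g h : G} (hg : IsLoxodromicAt δ o g)
    (H : ∀ u v : G, (u = g ∨ u = g⁻¹) → (v = g ∨ v = g⁻¹) →
      ¬ AsymptoticSeq o (fun n => h • u ^ n • o) fun n => v ^ n • o) :
    ∃ φ : FreeGroup (Fin 2) →* G, Function.Injective φ := by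
  have hδ := hX.nonneg o
  have hlox : ∀ u : G, (u = g ∨ u = g⁻¹) → IsLoxodromicAt δ o u := by
    rintro u (rfl | rfl)
    exacts [hg, hg.inv]
  have hbd : ∀ u v : G, (u = g ∨ u = g⁻¹) → (v = g ∨ v = g⁻¹) →
      ∃ K : ℝ, ∀ᶠ n in atTop, gromovProduct o (h • u ^ n • o) (v ^ n • o) ≤ K :=
    fun u v hu hv => (((hlox u hu).gromovSeq hX).smul h).eventually_le_of_not_asymptoticSeq hX
      ((hlox v hv).gromovSeq hX) (H u v hu hv)
  obtain ⟨K₁, h₁⟩ := hbd g g (.inl rfl) (.inl rfl)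
  obtain ⟨K₂, h₂⟩ := hbd g g⁻¹ (.inl rfl) (.inr rfl)
  obtain ⟨K₃, h₃⟩ := hbd g⁻¹ g (.inr rfl) (.inl rfl)
  obtain ⟨K₄, h₄⟩ := hbd g⁻¹ g⁻¹ (.inr rfl) (.inr rfl)
  set K₅ := gromovProduct o (g⁻¹ • o) (g • o) + 2 * δ
  have hK₅ : 0 ≤ K₅ := by
    have := gromovProduct_nonneg o (g⁻¹ • o) (g • o)
    positivity
  set M := max (max (max K₁ K₂) (max K₃ K₄)) K₅
  have hM₁ : K₁ ≤ M := by simp [M]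
  have hM₂ : K₂ ≤ M := by simp [M]
  have hM₃ : K₃ ≤ M := by simp [M]
  have hM₄ : K₄ ≤ M := by simp [M]
  have hM₅ : K₅ ≤ M := by simp [M]
  set d := dist o (h • o)
  have hd : 0 ≤ d := dist_nonneg
  -- Conjugating by `h` changes a Gromov product by at most `3 * d`, namely `d` for the base point
  -- and for each endpoint, and a displacement by at most `2 * d`.
  obtain ⟨L, hL⟩ := exists_nat_ge (2 * (M + 3 * d) + 2 * δ + 1 + 2 * d)
  obtain ⟨n, hn₁, hn₂, hn₃, hn₄, hnL⟩ :=
    (h₁.and (h₂.and (h₃.and (h₄.and (eventually_ge_atTop L))))).exists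
  have hnL' : (L : ℝ) ≤ n := by exact_mod_cast hnL
  have hconj : ∀ u : G, dist (h • u • o) ((h * u * h⁻¹) • o) = d := by
    intro u
    rw [mul_smul, mul_smul, dist_smul, dist_smul, dist_inv_smul_self]
  have hgn := (hg.pow_bounds hX n).2
  have hself : ∀ u : G, (u = g ∨ u = g⁻¹) → gromovProduct o (u⁻¹ ^ n • o) (u ^ n • o) ≤ M := by
    rintro u (rfl | rfl)
    · exact (hg.gromovProduct_pow_le hX n n).trans hM₅
    · rw [gromovProduct_comm, inv_inv]
      exact (hg.gromovProduct_pow_le hX n n).trans hM₅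
  have hmix : ∀ u v : G, (u = g ∨ u = g⁻¹) → (v = g ∨ v = g⁻¹) →
      gromovProduct o (v ^ n • o) ((h * u ^ n * h⁻¹) • o) ≤ M + d := by
    intro u v hu hv
    have h1 := gromovProduct_le_add_dist_right o (v ^ n • o) ((h * u ^ n * h⁻¹) • o) (h • u ^ n • o)
    rw [dist_comm, hconj, gromovProduct_comm o _ (h • u ^ n • o)] at h1
    rcases hu with rfl | rfl <;> rcases hv with rfl | rfl <;> linarith
  have hconjself : ∀ u : G, (u = g ∨ u = g⁻¹) →
      gromovProduct o ((h * u⁻¹ ^ n * h⁻¹) • o) ((h * u ^ n * h⁻¹) • o) ≤ M + 3 * d := by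
    intro u hu
    have h1 := gromovProduct_le_add_dist_base o (h • o) ((h * u⁻¹ ^ n * h⁻¹) • o)
      ((h * u ^ n * h⁻¹) • o)
    have h2 := gromovProduct_le_add_dist_right (h • o) ((h * u⁻¹ ^ n * h⁻¹) • o)
      ((h * u ^ n * h⁻¹) • o) (h • u ^ n • o)
    have h3 := gromovProduct_le_add_dist_right (h • o) (h • u ^ n • o)
      ((h * u⁻¹ ^ n * h⁻¹) • o) (h • u⁻¹ ^ n • o)
    rw [dist_comm, hconj, gromovProduct_comm _ _ (h • u ^ n • o)] at h2
    rw [dist_comm _ (h • u⁻¹ ^ n • o), hconj, gromovProduct_smul, gromovProduct_comm o] at h3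
    linarith [hself u hu]
  have hw : ∀ b : Bool, cond b g g⁻¹ = g ∨ cond b g g⁻¹ = g⁻¹ := by
    rintro (_ | _) <;> simp
  have hw' : ∀ b : Bool, (cond b g g⁻¹)⁻¹ = g ∨ (cond b g g⁻¹)⁻¹ = g⁻¹ := by
    rintro (_ | _) <;> simp
  have e₀ : ∀ b : Bool, cond b (g ^ n) (g ^ n)⁻¹ = cond b g g⁻¹ ^ n := by
    rintro (_ | _) <;> simp
  have e₁ : ∀ b : Bool, cond b (h * g ^ n * h⁻¹) (h * g ^ n * h⁻¹)⁻¹ =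
      h * cond b g g⁻¹ ^ n * h⁻¹ := by
    rintro (_ | _) <;> simp [mul_assoc]
  have e₂ : ∀ u : G, (h * u ^ n * h⁻¹)⁻¹ = h * u⁻¹ ^ n * h⁻¹ := by
    intro u
    simp [mul_assoc]
  refine ⟨FreeGroup.lift ![g ^ n, h * g ^ n * h⁻¹], hX.injective_lift (o := o) _
    (K := M + 3 * d) (by linarith) ?_ ?_⟩
  · have h1 := dist_triangle4 (h • o) o ((h * g ^ n * h⁻¹) • o) (h • g ^ n • o)
    rw [dist_smul, dist_comm _ (h • g ^ n • o), hconj, dist_comm (h • o)] at h1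
    simp only [Fin.forall_fin_two, Matrix.cons_val_zero, Matrix.cons_val_one]
    constructor <;> linarith
  · rintro ⟨i, b⟩ ⟨j, c⟩ hbc
    fin_cases i <;> fin_cases j <;>
      simp only [Fin.zero_eta, Fin.mk_one, Matrix.cons_val_zero, Matrix.cons_val_one, e₀, e₁] <;>
      simp only [e₂, ← inv_pow]
    · obtain rfl : b = c := hbc rfl
      linarith [hself _ (hw b)]
    · linarith [hmix _ _ (hw c) (hw' b)]
    · rw [gromovProduct_comm]
      linarith [hmix _ _ (hw' b) (hw c)]
    · obtain rfl : b = c := hbc rfl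
      exact hconjself _ (hw b)

/-- An action on a hyperbolic space with an unbounded orbit fixes, up to finite index, a point at
infinity, unless the group contains a free group of rank two. -/
theorem exists_free_or_exists_finiteIndex_fixing (hX : FourPoint δ X)
    (hunb : ∀ B : ℝ, ∃ g : G, B ≤ dist o (g • o)) :
    (∃ φ : FreeGroup (Fin 2) →* G, Function.Injective φ) ∨
      ∃ (H : Subgroup G) (x : ℕ → X), H.FiniteIndex ∧ GromovSeq o x ∧
        ∀ g ∈ H, AsymptoticSeq o (fun n => g • x n) x := by
  by_cases hlox : ∃ g : G, IsLoxodromicAt δ o g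
  · obtain ⟨g, hg⟩ := hlox
    refine or_iff_not_imp_left.2 fun hfree => ?_
    have hcase : ∀ h : G, ∃ u v : G, (u = g ∨ u = g⁻¹) ∧ (v = g ∨ v = g⁻¹) ∧
        AsymptoticSeq o (fun n => h • u ^ n • o) fun n => v ^ n • o := by
      intro h
      by_contra hcon
      push Not at hcon
      exact hfree (hg.exists_free hX hcon)
    have hseq : ∀ b : Bool, GromovSeq o fun n => (cond b g g⁻¹) ^ n • o := by
      rintro (_ | _)
      exacts [hg.inv.gromovSeq hX, hg.gromovSeq hX]
    -- Every `h` sends some end of `g` to some end of `g`. Hence `G` is covered by four cosets of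
    -- stabilizers of ends, and by Neumann's lemma one of these has finite index.
    choose c hc using fun p : Bool × Bool => exists_coset_of_asymptoticSeq (G := G) hX
      (hseq p.1).asymptoticSeq fun n => (cond p.2 g g⁻¹) ^ n • o
    obtain ⟨p, -, hp⟩ := Subgroup.exists_finiteIndex_of_leftCoset_cover
      (H := fun p : Bool × Bool => seqStabilizer hX G (hseq p.1).asymptoticSeq)
      (g := c) (s := Finset.univ) (by
        refine Set.eq_univ_of_forall fun h => ?_
        obtain ⟨u, v, hu, hv, huv⟩ := hcase h
        obtain ⟨b, rfl⟩ : ∃ b : Bool, u = cond b g g⁻¹ := by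
          rcases hu with rfl | rfl
          exacts [⟨true, rfl⟩, ⟨false, rfl⟩]
        obtain ⟨b', rfl⟩ : ∃ b : Bool, v = cond b g g⁻¹ := by
          rcases hv with rfl | rfl
          exacts [⟨true, rfl⟩, ⟨false, rfl⟩]
        simp only [Set.mem_iUnion]
        exact ⟨(b, b'), Finset.mem_univ _, Set.mem_smul_set_iff_inv_smul_mem.2
          (hc (b, b') h huv)⟩)
    exact ⟨_, _, hp, hseq p.1, fun g hg => mem_seqStabilizer.1 hg⟩
  · right
    push Not at hlox
    -- Without loxodromic elements no two long elements are transverse, so all orbit points far from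
    -- `o` converge to one point at infinity, fixed by the whole group.
    have key : ∀ g h : G, (min (dist o (g • o)) (dist o (h • o)) - 8 * δ - 1) / 2 ≤
        gromovProduct o (g • o) (h • o) := by
      intro g h
      by_contra hcon
      push Not at hcon
      have h1 := min_le_left (dist o (g • o)) (dist o (h • o))
      have h2 := min_le_right (dist o (g • o)) (dist o (h • o))
      exact hlox _ (isLoxodromicAt_mul hX (hlox g) (hlox h) (by linarith) (by linarith))
    choose g hg using fun n : ℕ => hunb n
    refine ⟨⊤, fun n => g n • o, inferInstance, fun B => ?_, fun h _ => ?_⟩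
    · obtain ⟨N, hN⟩ := exists_nat_ge (2 * B + 8 * δ + 1)
      refine ⟨N, fun m hm n hn => le_trans ?_ (key _ _)⟩
      have h1 : (N : ℝ) ≤ m := by exact_mod_cast hm
      have h2 : (N : ℝ) ≤ n := by exact_mod_cast hn
      linarith [le_min (h1.trans (hg m)) (h2.trans (hg n))]
    · refine tendsto_atTop.2 fun B => ?_
      obtain ⟨N, hN⟩ := exists_nat_ge (2 * B + 8 * δ + 1 + dist o (h • o))
      filter_upwards [eventually_ge_atTop N] with n hn
      have h2 : (N : ℝ) ≤ n := by exact_mod_cast hn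
      have h3 := key (h * g n) (g n)
      have h4 : dist o (g n • o) ≤ dist o ((h * g n) • o) + dist o (h • o) := by
        have := dist_triangle (h • o) o ((h * g n) • o)
        rw [mul_smul, dist_smul, dist_comm (h • o), ← mul_smul] at this
        linarith
      have h5 : 2 * B + 8 * δ + 1 ≤ min (dist o ((h * g n) • o)) (dist o (g n • o)) :=
        le_min (by linarith [hg n]) (by linarith [hg n, dist_nonneg (x := o) (y := h • o)])
      rw [mul_smul] at h3 h5
      linarith

end Asymptotic

/-! ### Horofunctions and their quasimorphisms -/

section Horofunction

variable {X G : Type*} [MetricSpace X] [Group G] [MulAction G X] [IsIsometricSMul G X]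
  {δ : ℝ} {o : X}

/-- A horofunction centred at the limit of a Gromov sequence, with its hyperbolicity inequality, its
coarse invariance under the stabilizer of the centre, and points converging to the centre. -/
theorem exists_horofunction (hX : IsHyperbolicSpace δ X) {x : ℕ → X} (hx : GromovSeq o x) :
    ∃ h : X → ℝ, h o = 0 ∧
      (∀ a b c, dist a b + h c ≤ max (dist a c + h b) (dist b c + h a) + 2 * δ) ∧
      (∀ g : G, AsymptoticSeq o (fun n => g • x n) x →
        ∀ a b, |h (g • a) - h (g • b) - (h a - h b)| ≤ 2 * δ) ∧
      ∀ s : ℝ, 0 ≤ s → ∃ y, dist o y = s ∧ h y ≤ -s + δ := by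
  have h4 := hX.fourPoint
  -- The values lie in a compact interval, so an ultrafilter gives limits at all points at once,
  -- without properness of `X`.
  have hlim : ∀ a : X, ∃ r : ℝ,
      Tendsto (fun n => dist a (x n) - dist o (x n)) (hyperfilter ℕ : Filter ℕ) (𝓝 r) := by
    intro a
    have hc : IsCompact (Set.Icc (-dist a o) (dist a o)) := isCompact_Icc
    obtain ⟨r, -, hr⟩ := hc.ultrafilter_le_nhds
      ((hyperfilter ℕ).map fun n => dist a (x n) - dist o (x n)) (by
        refine tendsto_principal.2 (Filter.Eventually.of_forall fun n => ?_)
        have h1 := dist_triangle a o (x n)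
        have h2 := dist_triangle o a (x n)
        have h3 := dist_comm o a
        constructor <;> linarith)
    exact ⟨r, hr⟩
  choose h hh using hlim
  refine ⟨h, ?_, ?_, ?_, ?_⟩
  · refine tendsto_nhds_unique (hh o) ?_
    simp
  · intro a b c
    refine le_of_tendsto_of_tendsto' (tendsto_const_nhds.add (hh c))
      (((tendsto_const_nhds.add (hh b)).max (tendsto_const_nhds.add (hh a))).add_const (2 * δ))
      fun n => ?_
    have := h4.dist_add_dist_le a b c (x n)
    rcases max_cases (dist a c + dist b (x n)) (dist a (x n) + dist b c) with ⟨h, -⟩ | ⟨h, -⟩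
    · have := le_max_left (dist a c + (dist b (x n) - dist o (x n)))
        (dist b c + (dist a (x n) - dist o (x n)))
      linarith
    · have := le_max_right (dist a c + (dist b (x n) - dist o (x n)))
        (dist b c + (dist a (x n) - dist o (x n)))
      linarith
  · intro g hg a b
    refine le_of_tendsto ((((hh (g • a)).sub (hh (g • b))).sub ((hh a).sub (hh b))).abs) ?_
    refine Filter.Eventually.filter_mono Nat.hyperfilter_le_atTop ?_
    filter_upwards [tendsto_atTop.1 hg (dist (g • a) (g • b) + 2 * δ + dist o (g • a) +
      dist o (g • b) + 1)] with n hn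
    have hδ := h4.nonneg o
    have e1 : dist a (x n) = dist (g • a) (g • x n) := (dist_smul g _ _).symm
    have e2 : dist b (x n) = dist (g • b) (g • x n) := (dist_smul g _ _).symm
    rw [e1, e2]
    generalize g • a = p at *
    generalize g • b = q at *
    generalize g • x n = w at *
    have a1 := h4.dist_add_dist_le p (x n) q w
    have a2 := h4.dist_add_dist_le p w q (x n)
    have t1 := dist_triangle o p (x n)
    have t2 := dist_triangle o p w
    have t3 := dist_triangle o q (x n)
    have t4 := dist_triangle o q w
    have c1 := dist_comm w (x n)
    have c2 := dist_comm w q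
    have c3 := dist_comm (x n) q
    have c4 := dist_comm w o
    have d1 := dist_nonneg (x := p) (y := q)
    have d2 := dist_nonneg (x := o) (y := p)
    have d3 := dist_nonneg (x := o) (y := q)
    unfold gromovProduct at hn
    rw [abs_le]
    constructor
    · rcases max_cases (dist p q + dist w (x n)) (dist p (x n) + dist w q) with ⟨h, -⟩ | ⟨h, -⟩ <;>
        linarith
    · rcases max_cases (dist p q + dist (x n) w) (dist p w + dist (x n) q) with ⟨h, -⟩ | ⟨h, -⟩ <;>
        linarith
  · intro s hs
    -- The point at distance `s` on the geodesic to `x N` is within `δ` of the geodesics to all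
    -- later `x n`.
    obtain ⟨N, hN⟩ := hx s
    obtain ⟨γ, hγ⟩ := hX.1 o (x N)
    have hsN : ∀ n ≥ N, s ≤ dist o (x n) := fun n hn =>
      (hN n hn n hn).trans (gromovProduct_le_dist _ _ _)
    refine ⟨γ s, hγ.dist_left hs (hsN N le_rfl), le_of_tendsto (hh (γ s)) ?_⟩
    refine Filter.Eventually.filter_mono Nat.hyperfilter_le_atTop ?_
    filter_upwards [eventually_ge_atTop N] with n hn
    obtain ⟨η, hη⟩ := hX.1 o (x n)
    have h1 := hX.2 o (x N) (x n) γ η hγ hη s ⟨hs, hN N le_rfl n hn⟩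
    have h2 := hη.dist_right hs (hsN n hn)
    have h3 := dist_triangle (γ s) (η s) (x n)
    linarith

/-- On the subgroup `H` the function `f` is a quasimorphism, and along the sequence `y` it
controls, up to a bounded error, how far the elements of `H` move points. -/
def ControlsDisplacement (H : Subgroup G) (f : G → ℝ) (C : ℝ) (y : ℕ → X) : Prop :=
  (∀ g ∈ H, ∀ k ∈ H, |f (g * k) - f g - f k| ≤ C) ∧
    ∀ g ∈ H, ∀ᶠ n in atTop, dist (g • y n) (y n) ≤ |f g| + C

/-- The quasimorphism is `g ↦ h (g • o)`, with `y n` at distance `n` from `o` and `h (y n)` at most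
`-n + δ`. Near the fixed point `g` acts like a shift by `f g` along a ray; transverse motion is
absorbed by hyperbolicity. -/
theorem exists_controlsDisplacement_of_fixing (hX : IsHyperbolicSpace δ X) {H : Subgroup G}
    {x : ℕ → X} (hx : GromovSeq o x) (hH : ∀ g ∈ H, AsymptoticSeq o (fun n => g • x n) x) :
    ∃ (f : G → ℝ) (C : ℝ) (y : ℕ → X), ControlsDisplacement H f C y ∧
      Tendsto (fun n => dist (y 0) (y n)) atTop atTop := by
  obtain ⟨h, h0, hyp, hinv, hpt⟩ := exists_horofunction (G := G) hX hx
  have hδ := hX.fourPoint.nonneg o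
  choose y hy1 hy2 using fun n : ℕ => hpt n n.cast_nonneg
  refine ⟨fun g => h (g • o), 5 * δ, y, ⟨fun g hg k hk => ?_, fun g hg => ?_⟩, ?_⟩
  · have := hinv g (hH g hg) (k • o) o
    rw [h0, sub_zero, ← mul_smul] at this
    linarith
  · obtain ⟨N, hN⟩ := exists_nat_ge (|h (g • o)| + dist o (g • o) + 3 * δ)
    filter_upwards [eventually_ge_atTop N] with n hn
    have hn' : (N : ℝ) ≤ n := by exact_mod_cast hn
    have hyn := hy1 n
    have hyn' := hy2 n
    set f := h (g • o)
    have b1 : h (g • y n) ≤ f - n + 3 * δ := by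
      have := (abs_le.1 (hinv g (hH g hg) (y n) o)).2
      linarith
    have b2 : dist (g • y n) o ≤ n - f + 2 * δ := by
      have := hyp (g • y n) o (g • o)
      rw [dist_smul, dist_comm (y n), hyn, h0] at this
      have e1 := neg_abs_le f
      have e2 := le_abs_self f
      have e3 := dist_nonneg (x := o) (y := g • o)
      rcases max_cases ((n : ℝ) + 0) (dist o (g • o) + h (g • y n)) with ⟨h, -⟩ | ⟨h, -⟩ <;>
        linarith
    have b3 := hyp (g • y n) (y n) o
    rw [h0, dist_comm (y n) o, hyn] at b3
    have e1 := neg_abs_le f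
    have e2 := le_abs_self f
    rcases max_cases (dist (g • y n) o + h (y n)) (n + h (g • y n)) with ⟨h, -⟩ | ⟨h, -⟩ <;>
      linarith
  · have hy0 : o = y 0 := by
      have := hy1 0
      simpa using this
    rw [← hy0]
    simpa only [hy1] using tendsto_natCast_atTop_atTop (R := ℝ)

/-- The alternative for an action on a single hyperbolic space. -/
theorem exists_free_or_exists_controlsDisplacement (hX : IsHyperbolicSpace δ X) (o : X) :
    (∃ φ : FreeGroup (Fin 2) →* G, Function.Injective φ) ∨
      ∃ (H : Subgroup G) (f : G → ℝ) (C : ℝ) (y : ℕ → X), H.FiniteIndex ∧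
        ControlsDisplacement H f C y ∧
        ((∃ B : ℝ, ∀ g : G, dist o (g • o) ≤ B) ∨
          Tendsto (fun n => dist (y 0) (y n)) atTop atTop) := by
  by_cases hb : ∃ B : ℝ, ∀ g : G, dist o (g • o) ≤ B
  · right
    obtain ⟨B, hB⟩ := hb
    have hB0 : 0 ≤ B := by simpa using hB 1
    refine ⟨⊤, 0, B, fun _ => o, inferInstance, ⟨by simpa using hB0, fun g _ => ?_⟩, .inl ⟨B, hB⟩⟩
    refine Filter.Eventually.of_forall fun _ => ?_
    simpa [dist_comm] using hB g
  · push Not at hb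
    refine (exists_free_or_exists_finiteIndex_fixing (o := o) hX.fourPoint
      fun B => (hb B).imp fun g hg => hg.le).imp id ?_
    rintro ⟨H, x, hfin, hx, hH⟩
    obtain ⟨f, C, y, hc, ht⟩ := exists_controlsDisplacement_of_fixing hX hx hH
    exact ⟨H, f, C, y, hfin, hc, .inr ht⟩

end Horofunction

/-! ### Quasimorphisms on groups with finite commutator subgroup -/

section Quasimorphism

variable {G : Type*} [Group G]

theorem mul_pow_div_mem_commutator (a b : G) (m : ℕ) :
    (a ^ m * b ^ m)⁻¹ * (a * b) ^ m ∈ commutator G := by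
  rw [← Abelianization.ker_of, MonoidHom.mem_ker]
  simp [mul_pow]

/-- A quasimorphism on a group with finite commutator subgroup is at bounded distance from a
homomorphism. -/
theorem exists_hom_near_quasimorphism [Finite (commutator G)] {f : G → ℝ} {C : ℝ}
    (hf : ∀ g k, |f (g * k) - f g - f k| ≤ C) :
    ∃ F : G →* Multiplicative ℝ, ∀ g, |f g - (F g).toAdd| ≤ C := by
  -- Homogenization along powers of two: the increments sum to `C`.
  have hstep : ∀ g : G, ∀ n : ℕ, dist (f (g ^ 2 ^ n) / 2 ^ n) (f (g ^ 2 ^ (n + 1)) / 2 ^ (n + 1)) ≤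
      C / 2 / 2 ^ n := by
    intro g n
    have h1 := hf (g ^ 2 ^ n) (g ^ 2 ^ n)
    rw [← pow_add, ← two_mul, ← pow_succ'] at h1
    have h2 : f (g ^ 2 ^ n) / 2 ^ n - f (g ^ 2 ^ (n + 1)) / 2 ^ (n + 1) =
        -(f (g ^ 2 ^ (n + 1)) - f (g ^ 2 ^ n) - f (g ^ 2 ^ n)) / 2 / 2 ^ n := by
      field_simp
      ring
    rw [Real.dist_eq, h2, abs_div, abs_div, abs_neg, abs_two,
      abs_of_pos (by positivity : (0 : ℝ) < 2 ^ n)]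
    gcongr
  choose F hF using fun g => cauchySeq_tendsto_of_complete (cauchySeq_of_le_geometric_two (hstep g))
  obtain ⟨M, hM⟩ : ∃ M : ℝ, ∀ c ∈ commutator G, |f c| ≤ M := by
    obtain ⟨M, hM⟩ := (Set.finite_range fun c : commutator G => |f c|).bddAbove
    exact ⟨M, fun c hc => hM ⟨⟨c, hc⟩, rfl⟩⟩
  have hadd : ∀ a b, F (a * b) = F a + F b := by
    intro a b
    have h1 := ((hF (a * b)).sub (hF a)).sub (hF b)
    -- The powers `(a * b) ^ m` and `a ^ m * b ^ m` differ by a commutator element, on which `f` is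
    -- at most `M`; two defects `C` are added, and the total vanishes after division by `2 ^ n`.
    have h2 : Tendsto (fun n : ℕ => (2 * C + M) * (1 / 2 : ℝ) ^ n) atTop (𝓝 0) := by
      simpa using (tendsto_pow_atTop_nhds_zero_of_lt_one (r := (1 / 2 : ℝ))
        (by norm_num) (by norm_num)).const_mul (2 * C + M)
    refine sub_eq_iff_eq_add'.1 (sub_eq_zero.1 (tendsto_nhds_unique h1 (squeeze_zero_norm
      (fun n => ?_) h2)))
    have c1 := hf (a ^ 2 ^ n) (b ^ 2 ^ n)
    have c2 := hf (a ^ 2 ^ n * b ^ 2 ^ n) ((a ^ 2 ^ n * b ^ 2 ^ n)⁻¹ * (a * b) ^ 2 ^ n)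
    have c3 := hM _ (mul_pow_div_mem_commutator a b (2 ^ n))
    rw [mul_inv_cancel_left] at c2
    have e : f ((a * b) ^ 2 ^ n) / 2 ^ n - f (a ^ 2 ^ n) / 2 ^ n - f (b ^ 2 ^ n) / 2 ^ n =
        (f ((a * b) ^ 2 ^ n) - f (a ^ 2 ^ n) - f (b ^ 2 ^ n)) * (1 / 2) ^ n := by
      rw [one_div, inv_pow]
      ring
    rw [e, Real.norm_eq_abs, abs_mul, abs_of_pos (by positivity : (0 : ℝ) < (1 / 2) ^ n)]
    gcongr
    rw [abs_le] at *
    constructor <;> linarith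
  refine ⟨MonoidHom.mk' (fun g => .ofAdd (F g)) fun a b => by rw [hadd, ofAdd_add], fun g => ?_⟩
  have := dist_le_of_le_geometric_two_of_tendsto₀ (hstep g) (hF g)
  simpa [Real.dist_eq] using this

/-- A homomorphism to `ℝ^D` all of whose preimages of bounded sets are finite factors through
some `ℤ^k`. -/
theorem exists_surjective_hom_of_finite_preimages {D : ℕ} (F : G →* Multiplicative (Fin D → ℝ))
    (hF : ∀ B : ℝ, {g | ‖(F g).toAdd‖ ≤ B}.Finite) :
    ∃ k ≤ D, ∃ ψ : G →* Multiplicative (Fin k → ℤ), Function.Surjective ψ ∧ Finite ψ.ker := by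
  let L : Submodule ℤ (Fin D → ℝ) := (Subgroup.toAddSubgroup' F.range).toIntSubmodule
  have hL : ∀ v, v ∈ L ↔ ∃ g, F g = .ofAdd v := fun v => Iff.rfl
  -- The unit ball meets the image in a finite set. A discrete subgroup of `ℝ^D` is free of rank
  -- equal to the dimension of its real span.
  have hdisc : DiscreteTopology L := by
    refine discreteTopology_of_isOpen_singleton_zero ?_
    refine isOpen_singleton_of_finite_mem_nhds 0 (Metric.closedBall_mem_nhds (0 : L) one_pos) ?_
    refine Set.Finite.of_finite_image (f := Subtype.val)
      (((hF 1).image fun g => (F g).toAdd).subset ?_) Subtype.val_injective.injOn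
    rintro _ ⟨⟨v, hv⟩, hv1, rfl⟩
    obtain ⟨g, hg⟩ := (hL v).1 hv
    refine ⟨g, ?_, by simp [hg]⟩
    simpa [hg] using hv1
  have hrank : Module.finrank ℤ L ≤ D := by
    have h1 := Real.finrank_eq_int_finrank_of_discrete (s := (L : Set (Fin D → ℝ)))
      (by rwa [Submodule.span_eq])
    rw [Set.finrank, Set.finrank, Submodule.span_eq] at h1
    rw [← h1]
    simpa using Submodule.finrank_le (Submodule.span ℝ (L : Set (Fin D → ℝ)))
  let b := Module.finBasis ℤ L
  let ψ₀ : G →* Multiplicative L :=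
    MonoidHom.mk' (fun g => .ofAdd ⟨(F g).toAdd, (hL _).2 ⟨g, rfl⟩⟩) fun g h => by
      rw [← ofAdd_add]
      congr 1
      ext1
      simp
  refine ⟨_, hrank, (AddEquiv.toMultiplicative b.equivFun.toAddEquiv).toMonoidHom.comp ψ₀,
    ?_, ?_⟩
  · refine (AddEquiv.toMultiplicative b.equivFun.toAddEquiv).surjective.comp ?_
    intro v
    obtain ⟨g, hg⟩ := (hL v.toAdd).1 v.toAdd.2
    refine ⟨g, ?_⟩
    apply Multiplicative.toAdd.injective
    ext1
    simp [ψ₀, hg]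
  · refine Set.Finite.subset (hF 0) fun g hg => ?_
    have h1 : ψ₀ g = 1 := by
      apply (AddEquiv.toMultiplicative b.equivFun.toAddEquiv).injective
      rw [map_one]
      exact hg
    have h2 : (F g).toAdd = 0 := congrArg (fun v : Multiplicative L => (v.toAdd : Fin D → ℝ)) h1
    exact (by rw [h2, norm_zero] : ‖(F g).toAdd‖ = 0).le

/-- A group with finitely many quasimorphisms that are jointly proper is finite by `ℤ^k`. -/
theorem exists_surjective_hom_of_quasimorphisms {D : ℕ} {f : Fin D → G → ℝ} {C : ℝ}
    (hf : ∀ i g k, |f i (g * k) - f i g - f i k| ≤ C)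
    (hfin : ∀ B : ℝ, {g | ∀ i, |f i g| ≤ B}.Finite) :
    ∃ k ≤ D, ∃ ψ : G →* Multiplicative (Fin k → ℤ), Function.Surjective ψ ∧ Finite ψ.ker := by
  have hcomm : Finite (commutatorSet G) := by
    -- Three defects split the commutator, one for each of the two inverse pairs reduces to `f i 1`,
    -- and `|f i 1| ≤ C` occurs twice. Finiteness of `commutator G` then follows by Schur's theorem.
    refine (hfin (7 * C)).subset ?_
    rintro _ ⟨a, b, rfl⟩ i
    have h1 := hf i 1 1
    have h2 := hf i a a⁻¹
    have h3 := hf i b b⁻¹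
    have h4 := hf i a b
    have h5 := hf i (a * b) a⁻¹
    have h6 := hf i (a * b * a⁻¹) b⁻¹
    rw [mul_one] at h1
    rw [mul_inv_cancel] at h2 h3
    rw [commutatorElement_def]
    rw [abs_le] at *
    constructor <;> linarith
  choose F hF using fun i => exists_hom_near_quasimorphism (hf i)
  let Φ : G →* Multiplicative (Fin D → ℝ) :=
    MonoidHom.mk' (fun g => .ofAdd fun i => (F i g).toAdd) fun g h => by
      rw [← ofAdd_add]
      congr 1
      ext i
      simp
  refine exists_surjective_hom_of_finite_preimages Φ fun B => (hfin (B + C)).subset ?_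
  intro g hg i
  have h1 : |(F i g).toAdd| ≤ B := (norm_le_pi_norm (Φ g).toAdd i).trans hg
  have h2 := hF i g
  rw [abs_le] at *
  constructor <;> linarith

theorem VirtuallyIsomorphic.of_surjective {Γ A : Type*} [Group Γ] [Group A] {H : Subgroup Γ}
    [H.FiniteIndex] (ψ : H →* A) (hψ : Function.Surjective ψ) [Finite ψ.ker] :
    VirtuallyIsomorphic Γ A :=
  ⟨H, ⊤, ψ.ker, ⊥, inferInstance, inferInstance, inferInstance, inferInstance, inferInstance,
    inferInstance, ⟨(QuotientGroup.quotientKerEquivOfSurjective ψ hψ).trans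
      (Subgroup.topEquiv.symm.trans QuotientGroup.quotientBot.symm)⟩⟩

end Quasimorphism

/-! ### Actions on finite families of hyperbolic spaces -/

/-- The alternative for a group acting on finitely many hyperbolic spaces such that the diagonal
action on their product is acylindrical and has an unbounded orbit. -/
theorem exists_free_or_exists_surjective_hom {G : Type*} [Group G] {D : ℕ} {X : Fin D → Type*}
    [∀ i, MetricSpace (X i)] [∀ i, MulAction G (X i)] [∀ i, IsIsometricSMul G (X i)] {δ : ℝ}
    (hX : ∀ i, IsHyperbolicSpace δ (X i)) (o : ∀ i, X i)
    (hacyl : ∀ ε : ℝ, 0 < ε → ∃ (R : ℝ) (N : ℕ), ∀ x y : ∀ i, X i, (∃ i, R ≤ dist (x i) (y i)) →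
      {g : G | ∀ i, dist (g • x i) (x i) ≤ ε ∧ dist (g • y i) (y i) ≤ ε}.encard ≤ N)
    (hunb : ¬ ∃ B : ℝ, ∀ (g : G) i, dist (o i) (g • o i) ≤ B) :
    (∃ φ : FreeGroup (Fin 2) →* G, Function.Injective φ) ∨
      ∃ k, 1 ≤ k ∧ k ≤ D ∧ ∃ (H : Subgroup G) (ψ : H →* Multiplicative (Fin k → ℤ)),
        H.FiniteIndex ∧ Function.Surjective ψ ∧ Finite ψ.ker := by
  refine or_iff_not_imp_left.2 fun hfree => ?_
  choose H f C y hHfin hctrl hdich using fun i =>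
    (exists_free_or_exists_controlsDisplacement (G := G) (hX i) (o i)).resolve_left hfree
  obtain ⟨i₀, hi₀⟩ : ∃ i, Tendsto (fun n => dist (y i 0) (y i n)) atTop atTop := by
    by_contra hcon
    push Not at hcon
    choose B hB using fun i => (hdich i).resolve_right (hcon i)
    obtain ⟨M, hM⟩ := (Set.finite_range B).bddAbove
    exact hunb ⟨M, fun g i => (hB i g).trans (hM ⟨i, rfl⟩)⟩
  obtain ⟨M, hM⟩ := (Set.finite_range C).bddAbove
  replace hM : ∀ i, C i ≤ M := fun i => hM ⟨i, rfl⟩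
  let K : Subgroup G := ⨅ i, H i
  have hK : K.FiniteIndex := Subgroup.finiteIndex_iInf hHfin
  have hKH : ∀ g : K, ∀ i, (g : G) ∈ H i := fun g i => (Subgroup.mem_iInf.1 g.2) i
  have hproper : ∀ B : ℝ, {g : K | ∀ i, |f i g| ≤ B}.Finite := by
    intro B
    by_contra hinf
    -- Any `N + 1` elements of the set displace `y i n` by at most `B + M` for all late `n`, and the
    -- factor `i₀` supplies two late points at distance at least `R`.
    obtain ⟨R, N, hRN⟩ := hacyl (max (B + M) 1) (by positivity)
    obtain ⟨t, hts, htc⟩ := Set.Infinite.exists_subset_card_eq hinf (N + 1)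
    have hev : ∀ᶠ n in atTop, ∀ g ∈ t, ∀ i, dist ((g : G) • y i n) (y i n) ≤ max (B + M) 1 := by
      rw [Filter.eventually_all_finset]
      intro g hg
      rw [Filter.eventually_all]
      intro i
      filter_upwards [(hctrl i).2 g (hKH g i)] with n hn
      exact le_max_of_le_left (by linarith [hts hg i, hM i])
    obtain ⟨n, hn⟩ := eventually_atTop.1 hev
    obtain ⟨m, hmR, hmn⟩ := ((tendsto_atTop.1 hi₀ (R + dist (y i₀ 0) (y i₀ n))).and
      (eventually_ge_atTop n)).exists
    have hcard := hRN (fun i => y i n) (fun i => y i m)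
      ⟨i₀, by linarith [dist_triangle (y i₀ 0) (y i₀ n) (y i₀ m)]⟩
    have hsub : ((t.map ⟨Subtype.val, Subtype.val_injective⟩ : Finset G) : Set G) ⊆
        {g : G | ∀ i, dist (g • y i n) (y i n) ≤ max (B + M) 1 ∧
          dist (g • y i m) (y i m) ≤ max (B + M) 1} := by
      intro g hg
      obtain ⟨g, hgt, rfl⟩ := Finset.mem_map.1 (Finset.mem_coe.1 hg)
      exact fun i => ⟨hn n le_rfl g hgt i, hn m hmn g hgt i⟩
    have := (Set.encard_le_encard hsub).trans hcard
    rw [Set.encard_coe_eq_coe_finsetCard, Finset.card_map, htc] at this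
    have : N + 1 ≤ N := by exact_mod_cast this
    omega
  obtain ⟨k, hkD, ψ, hψ, hker⟩ := exists_surjective_hom_of_quasimorphisms
    (f := fun i (g : K) => f i g) (C := M)
    (fun i g k => ((hctrl i).1 g (hKH g i) k (hKH k i)).trans (hM i)) hproper
  refine ⟨k, Nat.one_le_iff_ne_zero.2 ?_, hkD, K, ψ, hK, hψ, hker⟩
  rintro rfl
  have hKfin : Finite K := by
    have : ψ.ker = ⊤ := by
      ext g
      simp [MonoidHom.mem_ker, Subsingleton.elim (ψ g) 1]
    rw [this] at hker
    exact Finite.of_equiv _ Subgroup.topEquiv.toEquiv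
  have hGfin : Finite G := (Subgroup.finite_iff_finite_and_finiteIndex K).2 ⟨hKfin, hK⟩
  obtain ⟨B, hB⟩ := (Set.finite_range fun p : G × Fin D => dist (o p.2) (p.1 • o p.2)).bddAbove
  exact hunb ⟨B, fun g i => hB ⟨(g, i), rfl⟩⟩

/-! ### Automorphisms of products that preserve the factors -/

section Factorwise

variable {D : ℕ} (p : ℝ≥0∞) [Fact (1 ≤ p)] (X : Fin D → Type*) [∀ i, MetricSpace (X i)]

/-- The isometries of a product that preserve each of its factors. -/
def factorwise : Subgroup (PiLp p X ≃ᵢ PiLp p X) where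
  carrier := {f | ∀ i, ∃ e : X i ≃ᵢ X i, ∀ x : PiLp p X, f x i = e (x i)}
  one_mem' := fun i => ⟨IsometryEquiv.refl (X i), fun _ => rfl⟩
  mul_mem' := by
    intro f g hf hg i
    obtain ⟨e, he⟩ := hg i
    obtain ⟨e', he'⟩ := hf i
    refine ⟨e.trans e', fun x => ?_⟩
    change f (g x) i = e' (e (x i))
    rw [he', he]
  inv_mem' := by
    intro f hf i
    obtain ⟨e, he⟩ := hf i
    refine ⟨e.symm, fun x => ?_⟩
    have h := he (f⁻¹ x)
    rw [IsometryEquiv.apply_inv_self] at h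
    rw [h, IsometryEquiv.symm_apply_apply]

variable {p X}

theorem inv_mul_mem_factorwise {f g : PiLp p X ≃ᵢ PiLp p X} {σ : Equiv.Perm (Fin D)}
    (hf : ∀ i, ∃ e : X i ≃ᵢ X (σ i), ∀ x : PiLp p X, f x (σ i) = e (x i))
    (hg : ∀ i, ∃ e : X i ≃ᵢ X (σ i), ∀ x : PiLp p X, g x (σ i) = e (x i)) :
    f⁻¹ * g ∈ factorwise p X := by
  intro i
  obtain ⟨e, he⟩ := hf i
  obtain ⟨e', he'⟩ := hg i
  refine ⟨e'.trans e.symm, fun x => ?_⟩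
  have h := he (f⁻¹ (g x))
  rw [IsometryEquiv.apply_inv_self, he'] at h
  change f⁻¹ (g x) i = e.symm (e' (x i))
  rw [h, IsometryEquiv.symm_apply_apply]

/-- The permutation of an element need not be unique, so the chosen `σ` need not be a homomorphism.
It is enough that equal permutations force equal cosets. -/
theorem finiteIndex_comap_factorwise {Γ : Type*} [Group Γ] (ρ : Γ →* autProd p X) :
    ((factorwise p X).comap ((autProd p X).subtype.comp ρ)).FiniteIndex := by
  choose σ hσ using fun g : Γ => (ρ g).2
  rw [Subgroup.finiteIndex_iff_finite_quotient]
  refine Finite.of_injective (fun q => σ (Quotient.out q)) fun q q' h => ?_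
  rw [← QuotientGroup.out_eq' q, ← QuotientGroup.out_eq' q', QuotientGroup.eq,
    Subgroup.mem_comap, map_mul, map_inv]
  refine inv_mul_mem_factorwise (σ := σ q.out) (hσ q.out) ?_
  have := hσ q'.out
  simp only at h
  rw [h]
  exact this

/-- The action on a factor of a group that acts factorwise on a product. -/
theorem exists_factor_actions {H : Type*} [Group H] (ρ : H →* (PiLp p X ≃ᵢ PiLp p X))
    (hρ : ∀ g, ρ g ∈ factorwise p X) (o : PiLp p X) :
    ∃ (_ : ∀ i, MulAction H (X i)) (_ : ∀ i, IsIsometricSMul H (X i)),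
      ∀ g x i, ρ g x i = g • x i := by
  choose e he using hρ
  -- The base point `o` extends any point of a factor to the product, so the action laws descend to
  -- each factor.
  have hval : ∀ i (a : X i), ∃ x : PiLp p X, x i = a := fun i a =>
    ⟨WithLp.toLp p (Function.update (fun j => o j) i a), by simp⟩
  have hone : ∀ i (a : X i), e 1 i a = a := by
    intro i a
    obtain ⟨x, rfl⟩ := hval i a
    rw [← he, map_one]
    rfl
  have hmul : ∀ g h i (a : X i), e (g * h) i a = e g i (e h i a) := by
    intro g h i a
    obtain ⟨x, rfl⟩ := hval i a
    rw [← he, ← he, ← he, map_mul]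
    rfl
  let act : ∀ i, MulAction H (X i) := fun i =>
    { smul := fun g a => e g i a
      one_smul := hone i
      mul_smul := fun g h a => hmul g h i a }
  exact ⟨act, fun i => ⟨fun g => (e g i).isometry⟩, fun g x i => he g i x⟩

/-- The `ℓ^p` metric is dominated by the supremum metric. -/
theorem exists_dist_le_of_forall_dist_le (p : ℝ≥0∞) [Fact (1 ≤ p)] (X : Fin D → Type*)
    [∀ i, MetricSpace (X i)] : ∃ c : ℝ, 0 < c ∧ ∀ (x y : PiLp p X) (r : ℝ), 0 ≤ r →
      (∀ i, dist (x i) (y i) ≤ r) → dist x y ≤ c * r := by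
  refine ⟨((Fintype.card (Fin D) : NNReal) ^ (1 / p).toReal : NNReal) + 1, by positivity,
    fun x y r hr h => ?_⟩
  have h1 := (PiLp.antilipschitzWith_ofLp p X).le_mul_dist x y
  have h2 : dist (WithLp.ofLp x) (WithLp.ofLp y) ≤ r := (dist_pi_le_iff hr).2 h
  refine h1.trans ?_
  gcongr
  linarith

end Factorwise

theorem theoremA {Γ : Type*} [Group Γ] [Countable Γ] {D : ℕ} (X : Fin D → Type*)
    [∀ i, MetricSpace (X i)] [∀ i, CompleteSpace (X i)]
    [∀ i, TopologicalSpace.SeparableSpace (X i)]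
    (δ : ℝ) (hX : ∀ i, IsHyperbolicSpace δ (X i))
    (p : ℝ≥0∞) [Fact (1 ≤ p)] (ρ : Γ →* autProd p X)
    (hacyl : IsAcylindrical ((autProd p X).subtype.comp ρ))
    (hell : ¬ IsElliptic ((autProd p X).subtype.comp ρ)) :
    (∃ φ : FreeGroup (Fin 2) →* Γ, Function.Injective φ) ∨
      ∃ k : ℕ, 1 ≤ k ∧ k ≤ D ∧ VirtuallyIsomorphic Γ (Multiplicative (Fin k → ℤ)) := by
  set τ := (autProd p X).subtype.comp ρ with hτ
  unfold IsElliptic at hell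
  push Not at hell
  obtain ⟨o, ho⟩ := hell
  let Γ₀ := (factorwise p X).comap τ
  have hΓ₀ : Γ₀.FiniteIndex := finiteIndex_comap_factorwise ρ
  obtain ⟨act, isom, hact⟩ := exists_factor_actions (τ.comp Γ₀.subtype) (fun g => g.2) o
  obtain ⟨c, hc0, hc⟩ := exists_dist_le_of_forall_dist_le p X
  have main := exists_free_or_exists_surjective_hom (G := Γ₀) hX (fun i => o i) ?_ ?_
  · refine main.imp ?_ ?_
    · rintro ⟨φ, hφ⟩
      exact ⟨Γ₀.subtype.comp φ, Γ₀.subtype_injective.comp hφ⟩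
    · rintro ⟨k, hk1, hkD, H, ψ, hH, hψ, hker⟩
      refine ⟨k, hk1, hkD, ?_⟩
      let e := H.equivMapOfInjective Γ₀.subtype Γ₀.subtype_injective
      have hfin : (H.map Γ₀.subtype).FiniteIndex := by
        rw [Subgroup.finiteIndex_iff, Subgroup.index_map_subtype]
        exact mul_ne_zero hH.index_ne_zero hΓ₀.index_ne_zero
      have : Finite (ψ.comp e.symm.toMonoidHom).ker := by
        refine Finite.of_injective (β := ψ.ker) (fun g => ⟨e.symm g.1, g.2⟩) fun g g' h => ?_
        exact Subtype.ext (e.symm.injective (congrArg Subtype.val h))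
      exact VirtuallyIsomorphic.of_surjective (ψ.comp e.symm.toMonoidHom)
        (hψ.comp e.symm.surjective)
  · intro ε hε
    -- Coordinatewise displacement at most `ε` gives displacement at most `c * ε` in the product,
    -- while distance `R` in one coordinate already gives distance `R` there.
    obtain ⟨R, N, -, hRN⟩ := hacyl (c * ε) (by positivity)
    refine ⟨R, N, fun x y ⟨i, hi⟩ => ?_⟩
    have h1 := hRN (WithLp.toLp p x) (WithLp.toLp p y) (hi.trans (PiLp.dist_apply_le
      (WithLp.toLp p x) (WithLp.toLp p y) i))
    refine le_trans ?_ h1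
    rw [← Function.Injective.encard_image Γ₀.subtype_injective]
    refine Set.encard_le_encard ?_
    rintro _ ⟨g, hg, rfl⟩ z (rfl | rfl)
    · refine hc _ _ _ hε.le fun i => ?_
      have := hact g (WithLp.toLp p x) i
      exact (congrArg (dist · _) this).trans_le (hg i).1
    · refine hc _ _ _ hε.le fun i => ?_
      have := hact g (WithLp.toLp p y) i
      exact (congrArg (dist · _) this).trans_le (hg i).2
  · rintro ⟨B, hB⟩
    refine ho ?_
    have hB' : ∀ g : Γ₀, dist (τ g o) o ≤ c * |B| := by
      intro g
      refine hc _ _ _ (abs_nonneg B) fun i => ?_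
      have := hact g o i
      rw [dist_comm]
      exact (congrArg (dist _ ·) this).trans_le ((hB g i).trans (le_abs_self B))
    -- A bounded `Γ₀`-orbit makes the `Γ`-orbit bounded, as finitely many coset representatives add
    -- at most `M`.
    obtain ⟨M, hM⟩ := (Set.finite_range fun q : Γ ⧸ Γ₀ => dist (τ q.out o) o).bddAbove
    refine (Metric.isBounded_iff_subset_closedBall o).2 ⟨c * |B| + M, ?_⟩
    rintro _ ⟨g, rfl⟩
    obtain ⟨h, hh⟩ := QuotientGroup.mk_out_eq_mul Γ₀ g
    have e1 : g = (g : Γ ⧸ Γ₀).out * (h⁻¹ : Γ₀) := by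
      rw [hh]
      simp
    have e2 : τ g o = τ (g : Γ ⧸ Γ₀).out (τ (h⁻¹ : Γ₀) o) := by
      conv_lhs => rw [e1, map_mul]
      rfl
    have h1 := dist_triangle (τ g o) (τ (g : Γ ⧸ Γ₀).out o) o
    have h2 : dist (τ g o) (τ (g : Γ ⧸ Γ₀).out o) ≤ c * |B| := by
      rw [e2, IsometryEquiv.dist_eq]
      exact hB' _
    rw [Metric.mem_closedBall]
    linarith [hM ⟨(g : Γ ⧸ Γ₀), rfl⟩]
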